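/- A homomorphism $\varphi\colon A\to B$ of commutative rings is called Weierstrass if for every $b\in B$ there are $a\in A$ and a unit $b'\in B^\times$ with $b=\varphi(a)b'$. A local ring is called analytically unramified if its completion with respect to its maximal ideal is reduced; it is called unibranch if its reduction $A_{\mathrm{red}}$ is a domain and the integral closure of $A_{\mathrm{red}}$ in its field of fractions is a local ring. Let $A$ be a Noetherian local domain of dimension one with maximal ideal $\mathfrak m_A$, and let $\hat A$ be its $\mathfrak m_A$-adic completion. Then the following are equivalent: (i) the completion homomorphism $A\subseteq\hat A$ is Weierstrass; (ii) $A$ is analytically unramified and unibranch; (iii) $\hat A$ is a domain. -/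

import Mathlib

/-- A homomorphism `φ : A → B` of commutative rings is Weierstrass if every element of `B` is the
image of an element of `A` times a unit of `B`. -/
def RingHom.IsWeierstrass {A B : Type*} [CommRing A] [CommRing B] (φ : A →+* B) : Prop :=
  ∀ b : B, ∃ a : A, ∃ u : Bˣ, b = φ a * u

/-- The completion of a local ring `A` with respect to its maximal ideal. -/
abbrev LocalCompletion (A : Type*) [CommRing A] [IsLocalRing A] : Type _ :=
  AdicCompletion (IsLocalRing.maximalIdeal A) A

/-- A local ring is analytically unramified if its completion is reduced. -/
def IsAnalyticallyUnramified (A : Type*) [CommRing A] [IsLocalRing A] : Prop :=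
  IsReduced (LocalCompletion A)

/-- A local ring is unibranch if its reduction `A_red` is a domain and the integral closure of
`A_red` in its field of fractions is a local ring. -/
def IsUnibranch (A : Type*) [CommRing A] [IsLocalRing A] : Prop :=
  IsDomain (A ⧸ nilradical A) ∧
    IsLocalRing (integralClosure (A ⧸ nilradical A) (FractionRing (A ⧸ nilradical A)))

open IsLocalRing Polynomial

/-! Weierstrass implies domain because zero divisors of `Â` would descend to `A`. Conversely, in a
one-dimensional local domain `Â` a nonzero `b` generates an ideal containing a power of the maximal
ideal, so a close enough approximation from `A` is an associate of `b`.

The rest compares idempotents. If `Â` is reduced but not a domain, take nonzero `b`, `c` with `bc =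
0` and `b + c` outside all minimal primes. Approximations `b₀`, `c₀` give `x = b₀/(b₀ + c₀)` with
`x(1 - x)` in `A`, so `x` is integral. If the normalization is local, `x` or `1 - x` is a unit
there, which `eq_zero_of_isIntegral_inv` excludes. Conversely, if `x` and `1 - x` are nonunits of
the normalization, an idempotent of a quotient of `A[x]` lifts to an approximate idempotent.
Hensel's lemma in the domain `Â` forces it into `A`, near 0 or 1, a contradiction. -/

theorem LocalCompletion.evalₐ_algebraMap {A : Type*} [CommRing A] [IsLocalRing A] (n : ℕ) (a : A) :
    AdicCompletion.evalₐ (maximalIdeal A) n (algebraMap A (LocalCompletion A) a) =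
      Ideal.Quotient.mk _ a :=
  (AdicCompletion.evalₐ (maximalIdeal A) n).commutes a

/-! ### Approximation in the completion -/

section Completion

variable {A : Type*} [CommRing A] [IsLocalRing A] [IsNoetherianRing A]

namespace LocalCompletion

theorem mem_maximalIdeal_pow_iff (n : ℕ) (x : LocalCompletion A) :
    x ∈ maximalIdeal (LocalCompletion A) ^ n ↔
      AdicCompletion.evalₐ (maximalIdeal A) n x = 0 := by
  have hfg := (maximalIdeal A).fg_of_isNoetherianRing
  have h1 : x ∈ (AdicCompletion.eval (maximalIdeal A) A n).ker ↔
      AdicCompletion.evalₐ (maximalIdeal A) n x = 0 := by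
    have h : (maximalIdeal A ^ n • ⊤ : Ideal A) = maximalIdeal A ^ n := by simp
    rw [LinearMap.mem_ker]
    exact (map_eq_zero_iff (Ideal.quotientEquivAlgOfEq A h)
      (Ideal.quotientEquivAlgOfEq A h).injective).symm
  rw [← h1, ← AdicCompletion.pow_smul_top_eq_ker_eval hfg, AdicCompletion.maximalIdeal_eq_map,
    ← Ideal.map_pow, ← Submodule.restrictScalars_mem A, ← Ideal.smul_top_eq_map]

theorem algebraMap_mem_maximalIdeal_pow_iff (n : ℕ) (a : A) :
    algebraMap A (LocalCompletion A) a ∈ maximalIdeal (LocalCompletion A) ^ n ↔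
      a ∈ maximalIdeal A ^ n := by
  rw [mem_maximalIdeal_pow_iff, evalₐ_algebraMap, Ideal.Quotient.eq_zero_iff_mem]

theorem exists_sub_algebraMap_mem (n : ℕ) (x : LocalCompletion A) :
    ∃ a : A, x - algebraMap A (LocalCompletion A) a ∈ maximalIdeal (LocalCompletion A) ^ n := by
  obtain ⟨a, ha⟩ := Ideal.Quotient.mk_surjective (AdicCompletion.evalₐ (maximalIdeal A) n x)
  exact ⟨a, by rw [mem_maximalIdeal_pow_iff, map_sub, evalₐ_algebraMap, ha, sub_self]⟩

theorem algebraMap_injective : Function.Injective (algebraMap A (LocalCompletion A)) := by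
  refine (injective_iff_map_eq_zero _).2 fun a ha => ?_
  have : a ∈ ⨅ n : ℕ, maximalIdeal A ^ n := by
    rw [Ideal.mem_iInf]
    intro n
    rw [← algebraMap_mem_maximalIdeal_pow_iff, ha]
    exact zero_mem _
  rwa [Ideal.iInf_pow_eq_bot_of_isLocalRing _ (maximalIdeal.isMaximal A).ne_top] at this

/-- The quotient by the `k`-th power is also a quotient of `A`, hence Noetherian, and that power is
extended from `A`. -/
theorem fg_of_maximalIdeal_pow_le (k : ℕ) (I : Ideal (LocalCompletion A))
    (h : maximalIdeal (LocalCompletion A) ^ k ≤ I) : I.FG := by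
  have hnoeth : IsNoetherian (LocalCompletion A)
      (LocalCompletion A ⧸ maximalIdeal (LocalCompletion A) ^ k) := by
    let f : A →ₗ[A] LocalCompletion A ⧸ maximalIdeal (LocalCompletion A) ^ k :=
      (Algebra.linearMap A _)
    have hf : Function.Surjective f := by
      intro x
      obtain ⟨x, rfl⟩ := Ideal.Quotient.mk_surjective x
      obtain ⟨a, ha⟩ := exists_sub_algebraMap_mem k x
      exact ⟨a, (Ideal.Quotient.eq.2 ha).symm⟩
    exact isNoetherian_of_tower A (isNoetherian_of_surjective f (LinearMap.range_eq_top.2 hf))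
  refine Submodule.fg_of_fg_map_of_fg_inf_ker
    (Submodule.mkQ (maximalIdeal (LocalCompletion A) ^ k)) (IsNoetherian.noetherian _) ?_
  rw [Submodule.ker_mkQ, inf_eq_right.2 h, AdicCompletion.maximalIdeal_eq_map, ← Ideal.map_pow]
  exact (Ideal.fg_of_isNoetherianRing _).map _

end LocalCompletion

end Completion

/-! ### Nakayama's lemma over complete rings -/

theorem IsPrecomplete.pi_const {R ι : Type*} [CommRing R] [Finite ι] (I : Ideal R)
    [IsPrecomplete I R] : IsPrecomplete I (ι → R) := by
  classical
  have := Fintype.ofFinite ι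
  refine ⟨fun f hf => ?_⟩
  have key (n : ℕ) (x : ι → R) :
      x ∈ (I ^ n • ⊤ : Submodule R (ι → R)) ↔ ∀ i, x i ∈ (I ^ n • ⊤ : Submodule R R) := by
    constructor
    · intro hx i
      have := Submodule.mem_map_of_mem (f := LinearMap.proj (R := R) (φ := fun _ : ι => R) i) hx
      rw [Submodule.map_smul''] at this
      exact Submodule.smul_mono le_rfl le_top this
    · intro hx
      rw [pi_eq_sum_univ x]
      refine Submodule.sum_mem _ fun i _ => Submodule.smul_mem_smul ?_ trivial
      simpa using hx i
  have (i : ι) : ∃ L : R, ∀ n, f n i ≡ L [SMOD (I ^ n • ⊤ : Submodule R R)] := by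
    refine IsPrecomplete.prec ‹_› fun {m n} hmn => ?_
    have := hf hmn
    rw [SModEq.sub_mem, key] at this
    rw [SModEq.sub_mem]
    exact this i
  choose L hL using this
  refine ⟨L, fun n => ?_⟩
  rw [SModEq.sub_mem, key]
  intro i
  exact SModEq.sub_mem.1 (hL i n)

/-- A submodule generated modulo `I` by finitely many elements is finitely generated. -/
theorem Submodule.fg_of_le_sup_smul_of_isPrecomplete {R M : Type*} [CommRing R] [AddCommGroup M]
    [Module R M] (I : Ideal R) [IsPrecomplete I R] (N : Submodule R M) [IsHausdorff I N]
    (S : Submodule R M) (hS : S.FG) (hSN : S ≤ N) (h : N ≤ S ⊔ I • N) : N.FG := by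
  obtain ⟨n, v, rfl⟩ := Submodule.fg_iff_exists_fin_generating_family.1 hS
  have hv (i : Fin n) : v i ∈ N := hSN (Submodule.subset_span ⟨i, rfl⟩)
  let f : (Fin n → R) →ₗ[R] N := Fintype.linearCombination R (fun i => (⟨v i, hv i⟩ : N))
  have := IsPrecomplete.pi_const (ι := Fin n) I
  have hf : Function.Surjective (Submodule.mkQ (I • ⊤) ∘ₗ f) := by
    intro y
    obtain ⟨y, rfl⟩ := Submodule.mkQ_surjective _ y
    obtain ⟨s, hs, t, ht, hst⟩ := Submodule.mem_sup.1 (h y.2)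
    obtain ⟨c, hc⟩ := (Submodule.mem_span_range_iff_exists_fun R).1 hs
    refine ⟨c, ?_⟩
    rw [LinearMap.comp_apply, ← sub_eq_zero, ← map_sub, Submodule.mkQ_apply,
      Submodule.Quotient.mk_eq_zero, ← neg_mem_iff, Submodule.mem_smul_top_iff]
    convert ht
    simp [f, Fintype.linearCombination_apply, hc, ← hst]
  have hf' := surjective_of_mkQ_comp_surjective hf
  have : Module.Finite R N := Module.Finite.of_surjective f hf'
  exact Module.Finite.iff_fg.1 this

/-! ### Completions in dimension one -/

section DimensionOne

variable {A : Type*} [CommRing A] [IsDomain A] [IsLocalRing A] [IsNoetherianRing A]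
  [Ring.KrullDimLE 1 A]

theorem IsLocalRing.exists_maximalIdeal_pow_le_span_singleton {a : A} (ha : a ≠ 0) :
    ∃ k : ℕ, maximalIdeal A ^ k ≤ Ideal.span {a} := by
  refine Ideal.exists_pow_le_of_le_radical_of_fg ?_ (maximalIdeal A).fg_of_isNoetherianRing
  rw [Ideal.radical_eq_sInf]
  refine le_sInf fun P ⟨hP, hprime⟩ => ?_
  refine (eq_maximalIdeal (hprime.isMaximal_of_ne_bot ?_)).ge
  rintro rfl
  exact ha (by simpa using hP)

namespace LocalCompletion

/-- Since `(q)` contains a power of the maximal ideal, `r` may be replaced by an element of `A`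
modulo that power. -/
theorem dvd_of_algebraMap_eq_mul {p q : A} {r : LocalCompletion A} (hq : q ≠ 0)
    (h : algebraMap A (LocalCompletion A) p = algebraMap A (LocalCompletion A) q * r) : q ∣ p := by
  obtain ⟨k, hk⟩ := exists_maximalIdeal_pow_le_span_singleton hq
  obtain ⟨a, ha⟩ := exists_sub_algebraMap_mem k r
  have h1 : p - q * a ∈ maximalIdeal A ^ k := by
    rw [← algebraMap_mem_maximalIdeal_pow_iff, map_sub, map_mul, h, ← mul_sub]
    exact Ideal.mul_mem_left _ _ ha
  exact (dvd_sub_left (dvd_mul_right q a)).1 (Ideal.mem_span_singleton.1 (hk h1))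

theorem maximalIdeal_pow_le_span_singleton_of_algebraMap {s : A} (hs : s ≠ 0) {k : ℕ}
    (h : maximalIdeal (LocalCompletion A) ^ k ≤
      Ideal.span {algebraMap A (LocalCompletion A) s}) :
    maximalIdeal A ^ k ≤ Ideal.span {s} := by
  intro x hx
  obtain ⟨r, hr⟩ := Ideal.mem_span_singleton.1
    (h ((algebraMap_mem_maximalIdeal_pow_iff k x).2 hx))
  exact Ideal.mem_span_singleton.2 (dvd_of_algebraMap_eq_mul hs hr)

theorem exists_maximalIdeal_pow_le_span_algebraMap {a : A} (ha : a ≠ 0) :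
    ∃ k : ℕ, maximalIdeal (LocalCompletion A) ^ k ≤
      Ideal.span {algebraMap A (LocalCompletion A) a} := by
  obtain ⟨k, hk⟩ := exists_maximalIdeal_pow_le_span_singleton ha
  refine ⟨k, ?_⟩
  rw [AdicCompletion.maximalIdeal_eq_map, ← Ideal.map_pow, ← Set.image_singleton,
    ← Ideal.map_span]
  exact Ideal.map_mono hk

theorem eq_maximalIdeal_of_algebraMap_mem {a : A} (ha : a ≠ 0) {P : Ideal (LocalCompletion A)}
    [hP : P.IsPrime] (haP : algebraMap A (LocalCompletion A) a ∈ P) :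
    P = maximalIdeal (LocalCompletion A) := by
  obtain ⟨k, hk⟩ := exists_maximalIdeal_pow_le_span_algebraMap ha
  refine le_antisymm (le_maximalIdeal hP.ne_top) (hP.le_of_pow_le (hk.trans ?_))
  exact (Ideal.span_singleton_le_iff_mem _).2 haP

/-- By Cohen's criterion only primes matter. If `α ∉ P`, then `P ∩ (α) = αP`, so finitely many
generators of `P + (α)` yield generators of `P` modulo `αP`, and complete Nakayama applies. -/
theorem isNoetherianRing (hA : ¬ IsField A) : IsNoetherianRing (LocalCompletion A) := by
  obtain ⟨a, ham, ha⟩ := Submodule.exists_mem_ne_zero_of_ne_bot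
    (isField_iff_maximalIdeal_eq.not.1 hA)
  obtain ⟨k, hk⟩ := exists_maximalIdeal_pow_le_span_algebraMap ha
  refine IsNoetherianRing.of_prime fun P hP => ?_
  set α := algebraMap A (LocalCompletion A) a with hα
  by_cases haP : α ∈ P
  · exact fg_of_maximalIdeal_pow_le k P (hk.trans ((Ideal.span_singleton_le_iff_mem _).2 haP))
  obtain ⟨T, hT⟩ := fg_of_maximalIdeal_pow_le k (P ⊔ Ideal.span {α}) (hk.trans le_sup_right)
  have hsplit (t : T) : ∃ p ∈ P, t.1 - p ∈ Ideal.span {α} := by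
    have : t.1 ∈ P ⊔ Ideal.span {α} := hT ▸ Ideal.subset_span t.2
    obtain ⟨p, hp, y, hy, h⟩ := Submodule.mem_sup.1 this
    exact ⟨p, hp, by rw [← h]; simpa using hy⟩
  choose g hgP hg using hsplit
  have hαm : α ∈ maximalIdeal (LocalCompletion A) := by
    simpa only [pow_one] using (algebraMap_mem_maximalIdeal_pow_iff 1 a).2 (by simpa only [pow_one])
  have hSP : Ideal.span (Set.range g) ≤ P := by
    rw [Ideal.span_le]
    rintro _ ⟨t, rfl⟩
    exact hgP t
  have hhaus : IsHausdorff (maximalIdeal (LocalCompletion A)) P := by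
    refine ⟨fun x hx => Subtype.ext (IsHausdorff.haus
      (inferInstance : IsHausdorff (maximalIdeal (LocalCompletion A)) (LocalCompletion A)) _
      fun n => ?_)⟩
    have := hx n
    rw [SModEq.zero, Submodule.mem_smul_top_iff] at this
    rw [SModEq.zero]
    exact Submodule.smul_mono le_rfl le_top this
  refine Submodule.fg_of_le_sup_smul_of_isPrecomplete (maximalIdeal (LocalCompletion A)) P
    (Ideal.span (Set.range g)) (Submodule.fg_span (Set.finite_range g)) hSP fun x hx => ?_
  have hle : P ⊔ Ideal.span {α} ≤ Ideal.span (Set.range g) ⊔ Ideal.span {α} := by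
    rw [← hT, Ideal.span_le]
    intro t ht
    rw [← add_sub_cancel (g ⟨t, ht⟩) t]
    exact Submodule.add_mem_sup (Ideal.subset_span ⟨_, rfl⟩) (hg ⟨t, ht⟩)
  obtain ⟨y, hy, z, hz, hyz⟩ := Submodule.mem_sup.1 (hle (Ideal.mem_sup_left hx))
  obtain ⟨w, rfl⟩ := Ideal.mem_span_singleton.1 hz
  rw [← hyz]
  refine Submodule.add_mem_sup hy (Submodule.smul_mem_smul hαm ?_)
  refine (hP.mem_or_mem ?_).resolve_left haP
  rw [← eq_sub_iff_add_eq'] at hyz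
  exact hyz ▸ P.sub_mem hx (hSP hy)

/-- An element outside all minimal primes generates an ideal primary to the maximal ideal. -/
theorem exists_maximalIdeal_pow_le_span_singleton (hA : ¬ IsField A) {s : LocalCompletion A}
    (hs : ∀ P ∈ minimalPrimes (LocalCompletion A), s ∉ P) :
    ∃ k : ℕ, maximalIdeal (LocalCompletion A) ^ k ≤ Ideal.span {s} := by
  have := isNoetherianRing hA
  obtain ⟨a, ham, ha⟩ := Submodule.exists_mem_ne_zero_of_ne_bot
    (isField_iff_maximalIdeal_eq.not.1 hA)
  refine Ideal.exists_pow_le_of_le_radical_of_fg ?_ (Ideal.fg_of_isNoetherianRing _)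
  rw [Ideal.radical_eq_sInf]
  refine le_sInf fun P ⟨hP, hprime⟩ => ?_
  -- Krull's principal ideal theorem: the maximal ideal is minimal over the image of `a`.
  have hheight : (maximalIdeal (LocalCompletion A)).height ≤ 1 := by
    refine Ideal.height_le_one_of_isPrincipal_of_mem_minimalPrimes
      (Ideal.span {algebraMap A (LocalCompletion A) a}) _ ⟨⟨inferInstance, ?_⟩, ?_⟩
    · rw [Ideal.span_singleton_le_iff_mem]
      simpa only [pow_one] using (algebraMap_mem_maximalIdeal_pow_iff 1 a).2 (by simpa only [pow_one])
    · rintro Q ⟨hQ, hQa⟩ -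
      exact (eq_maximalIdeal_of_algebraMap_mem ha
        ((Ideal.span_singleton_le_iff_mem _).1 hQa)).ge
  have hle := le_maximalIdeal hprime.ne_top
  by_contra hlt
  have h0 : P.height < (maximalIdeal (LocalCompletion A)).height := by
    have : P.FiniteHeight := inferInstance
    exact Ideal.height_strict_mono_of_isPrime (lt_of_le_not_ge hle hlt)
  have h1 : P.height = 0 := Order.lt_one_iff.1 (h0.trans_le hheight)
  exact hs P (Ideal.height_eq_zero_iff.1 h1) ((Ideal.span_singleton_le_iff_mem _).1 hP)

end LocalCompletion

end DimensionOne

/-- An element close to a generator of a primary ideal is an associate of that generator. -/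
theorem IsLocalRing.associated_of_sub_mem {R : Type*} [CommRing R] [IsLocalRing R] {s t : R} {k : ℕ}
    (hk : maximalIdeal R ^ k ≤ Ideal.span {s}) (h : s - t ∈ maximalIdeal R ^ (k + 1)) :
    Associated s t := by
  have h1 : s - t ∈ Ideal.span {s} * maximalIdeal R := by
    rw [pow_succ] at h
    exact Ideal.mul_mono_left hk h
  obtain ⟨z, hz, hsz⟩ := Ideal.mem_span_singleton_mul.1 h1
  have hu : IsUnit (1 - z) := (isUnit_or_isUnit_one_sub_self z).resolve_left hz
  exact ⟨hu.unit, by rw [IsUnit.unit_spec]; linear_combination -hsz⟩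

/-! ### Weierstrass completions and domains -/

section

variable {A : Type*} [CommRing A] [IsDomain A] [IsLocalRing A] [IsNoetherianRing A]

theorem LocalCompletion.isDomain_of_isWeierstrass
    (h : (algebraMap A (LocalCompletion A)).IsWeierstrass) : IsDomain (LocalCompletion A) := by
  have : NoZeroDivisors (LocalCompletion A) := by
    refine ⟨fun {x y} hxy => ?_⟩
    obtain ⟨a, u, rfl⟩ := h x
    obtain ⟨b, v, rfl⟩ := h y
    have h0 : algebraMap A (LocalCompletion A) (a * b) = 0 := by
      rw [mul_mul_mul_comm, ← Units.val_mul, Units.mul_left_eq_zero] at hxy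
      rw [map_mul, hxy]
    rw [map_eq_zero_iff _ algebraMap_injective, mul_eq_zero] at h0
    rcases h0 with rfl | rfl <;> simp
  exact NoZeroDivisors.to_isDomain _

variable [Ring.KrullDimLE 1 A]

namespace LocalCompletion

theorem isWeierstrass_of_isDomain (hA : ¬ IsField A) [IsDomain (LocalCompletion A)] :
    (algebraMap A (LocalCompletion A)).IsWeierstrass := by
  intro b
  by_cases hb : b = 0
  · exact ⟨0, 1, by simp [hb]⟩
  obtain ⟨k, hk⟩ := exists_maximalIdeal_pow_le_span_singleton hA (s := b) (by
    rw [IsDomain.minimalPrimes_eq_singleton_bot]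
    simpa using hb)
  obtain ⟨a, ha⟩ := exists_sub_algebraMap_mem (k + 1) b
  obtain ⟨u, hu⟩ := (associated_of_sub_mem hk ha).symm
  exact ⟨a, u, hu.symm⟩

end LocalCompletion

end

/-! ### From a local normalization to a domain -/

/-- A reduced Noetherian ring that is not a domain has two elements with product zero whose sum
avoids all minimal primes. -/
theorem exists_mul_eq_zero_and_add_notMem_minimalPrimes {R : Type*} [CommRing R] [Nontrivial R]
    [IsNoetherianRing R] [IsReduced R] (h : ¬ IsDomain R) :
    ∃ b c : R, b ≠ 0 ∧ c ≠ 0 ∧ b * c = 0 ∧ ∀ P ∈ minimalPrimes R, b + c ∉ P := by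
  classical
  have hfin := minimalPrimes.finite_of_isNoetherianRing R
  have hzero (x : R) (hx : ∀ P ∈ minimalPrimes R, x ∈ P) : x = 0 := by
    have : x ∈ nilradical R := by
      rw [nilradical, ← Ideal.sInf_minimalPrimes, Ideal.mem_sInf]
      exact fun {P} hP => hx P hP
    simpa using this
  obtain ⟨P₀, hP₀⟩ := Ideal.nonempty_minimalPrimes (bot_ne_top (α := Ideal R))
  have hP₀p : P₀.IsPrime := hP₀.1.1
  have hne : ∃ P₁ ∈ minimalPrimes R, P₁ ≠ P₀ := by
    by_contra! hall
    have hbot : P₀ = ⊥ := (Submodule.eq_bot_iff _).2 fun x hx =>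
      hzero x fun P hP => (hall P hP).symm ▸ hx
    subst hbot
    exact h (IsDomain.of_bot_isPrime R)
  obtain ⟨P₁, hP₁, hP₁₀⟩ := hne
  let T : Finset (Ideal R) := hfin.toFinset.erase P₀
  have hT {P : Ideal R} : P ∈ T ↔ P ≠ P₀ ∧ P ∈ minimalPrimes R := by
    simp [T]
  -- Prime avoidance: `b` lies in `P₀` only, `c` in all minimal primes except `P₀`.
  obtain ⟨b, hb, hbT⟩ : ∃ b ∈ P₀, ∀ P ∈ T, b ∉ P := by
    by_contra! hcon
    obtain ⟨P, hPT, hle⟩ := (Ideal.subset_union_prime (s := T) (f := id) (I := P₀) ⊥ ⊥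
      (fun P hP _ _ => (hT.1 hP).2.1.1)).1 fun x hx => by
        obtain ⟨P, hP, hxP⟩ := hcon x hx
        exact Set.mem_biUnion (show P ∈ (T : Set (Ideal R)) from hP) hxP
    exact (hT.1 hPT).1 (le_antisymm ((hT.1 hPT).2.2 hP₀.1 hle) hle)
  obtain ⟨c, hcT, hc⟩ : ∃ c ∈ T.inf id, c ∉ P₀ := by
    by_contra! hcon
    obtain ⟨P, hPT, hle⟩ := (hP₀p.inf_le' (s := T) (f := id)).1 hcon
    exact (hT.1 hPT).1 (le_antisymm hle (hP₀.2 (hT.1 hPT).2.1 hle))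
  have hcT' (P : Ideal R) (hP : P ∈ T) : c ∈ P := (Finset.inf_le hP : T.inf id ≤ P) hcT
  refine ⟨b, c, ?_, ?_, hzero _ fun P hP => ?_, fun P hP hmem => ?_⟩
  · rintro rfl
    exact hbT P₁ (hT.2 ⟨hP₁₀, hP₁⟩) (zero_mem _)
  · rintro rfl
    exact hc (zero_mem _)
  · by_cases hPP : P = P₀
    · exact P.mul_mem_right _ (hPP ▸ hb)
    · exact P.mul_mem_left _ (hcT' P (hT.2 ⟨hPP, hP⟩))
  · by_cases hPP : P = P₀
    · subst hPP
      exact hc ((Ideal.add_mem_iff_right _ hb).1 hmem)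
    · exact hbT P (hT.2 ⟨hPP, hP⟩) ((Ideal.add_mem_iff_left _ (hcT' P (hT.2 ⟨hPP, hP⟩))).1 hmem)

/-- If `x⁻¹` is integral, then `x` is a root of a polynomial with constant coefficient one. -/
theorem IsIntegral.exists_coeff_zero_eq_one_of_inv {A K : Type*} [CommRing A] [Field K]
    [Algebra A K] {x : K} (hx : x ≠ 0) (h : IsIntegral A x⁻¹) :
    ∃ P : A[X], P.coeff 0 = 1 ∧ aeval x P = 0 := by
  obtain ⟨p, hp, hpx⟩ := h
  refine ⟨p.reverse, by rw [coeff_zero_reverse, hp.leadingCoeff], ?_⟩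
  let := invertibleOfNonzero (inv_ne_zero hx)
  have := eval₂_reverse_eq_zero_iff (algebraMap A K) x⁻¹ p
  rw [invOf_eq_inv, inv_inv] at this
  exact this.2 hpx

section

variable {A : Type*} [CommRing A] [IsLocalRing A] [IsNoetherianRing A]
  {K : Type*} [Field K] [Algebra A K] [IsFractionRing A K]

/-- After multiplication by `c`, the root `x` of `P` may be replaced by `δ`. But `P(δ)` is congruent
to 1 modulo the maximal ideal, hence a unit. `scaleRoots` clears denominators. -/
theorem LocalCompletion.eq_zero_of_isIntegral_inv {b s : A} {c δ : LocalCompletion A}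
    (hsc : algebraMap A (LocalCompletion A) s ∈ nonZeroDivisors (LocalCompletion A))
    (hδ : δ ∈ maximalIdeal (LocalCompletion A))
    (hc : c * algebraMap A (LocalCompletion A) b = c * (algebraMap A (LocalCompletion A) s * δ))
    {x : K} (hx : algebraMap A K b = algebraMap A K s * x) (hx0 : x ≠ 0)
    (hint : IsIntegral A x⁻¹) : c = 0 := by
  obtain ⟨P, hP0, hPx⟩ := hint.exists_coeff_zero_eq_one_of_inv hx0
  have hQ : eval b (P.scaleRoots s) = 0 := by
    have := scaleRoots_aeval_eq_zero (r := s) hPx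
    rw [← hx, aeval_algebraMap_apply, map_eq_zero_iff _ (IsFractionRing.injective A K)] at this
    simpa using this
  let f := algebraMap A (LocalCompletion A)
  have h1 : c * eval₂ f (f b) (P.scaleRoots s) = c * eval₂ f (f s * δ) (P.scaleRoots s) := by
    rw [← sub_eq_zero, ← mul_sub, eval₂_eq_eval_map, eval₂_eq_eval_map]
    obtain ⟨w, hw⟩ := sub_dvd_eval_sub (f b) (f s * δ) ((P.scaleRoots s).map f)
    rw [hw, ← mul_assoc, mul_sub, hc, sub_self, zero_mul]
  rw [eval₂_at_apply, hQ, map_zero, mul_zero, scaleRoots_eval₂_mul] at h1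
  have hu : IsUnit (eval₂ f δ P) := by
    by_contra hu
    have h2 : eval₂ f δ P - 1 ∈ maximalIdeal (LocalCompletion A) := by
      have := sub_dvd_eval_sub δ 0 (P.map f)
      rw [← coeff_zero_eq_eval_zero, coeff_map, hP0, map_one, sub_zero, ← eval₂_eq_eval_map] at this
      exact Ideal.mem_of_dvd _ this hδ
    have := sub_mem ((mem_maximalIdeal _).2 hu) h2
    rw [sub_sub_cancel] at this
    exact (Ideal.ne_top_iff_one _).1 (maximalIdeal.isMaximal _).ne_top this
  have h3 : c * f s ^ P.natDegree = 0 := by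
    rw [← mul_assoc] at h1
    exact (hu.mul_left_eq_zero).1 h1.symm
  exact (mul_right_mem_nonZeroDivisors_eq_zero_iff (pow_mem hsc _)).1 h3

end

theorem mem_nonZeroDivisors_of_notMem_minimalPrimes {R : Type*} [CommRing R] [IsReduced R] {s : R}
    (hs : ∀ P ∈ minimalPrimes R, s ∉ P) : s ∈ nonZeroDivisors R := by
  refine mem_nonZeroDivisors_iff_right.2 fun t ht => ?_
  have : t ∈ nilradical R := by
    rw [nilradical, ← Ideal.sInf_minimalPrimes, Ideal.mem_sInf]
    intro P hP
    exact (hP.1.1.mem_or_mem (ht ▸ P.zero_mem : t * s ∈ P)).resolve_right (hs P hP)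
  simpa using this

theorem integralClosure.isIntegral_inv_of_isUnit {A K : Type*} [CommRing A] [Field K] [Algebra A K]
    {x : integralClosure A K} (hx : IsUnit x) : x.1 ≠ 0 ∧ IsIntegral A x.1⁻¹ := by
  obtain ⟨u, rfl⟩ := hx
  have h : (u : integralClosure A K).1 * (↑u⁻¹ : integralClosure A K).1 = 1 := by
    rw [← MulMemClass.coe_mul, Units.mul_inv, OneMemClass.coe_one]
  refine ⟨left_ne_zero_of_mul_eq_one h, ?_⟩
  rw [inv_eq_of_mul_eq_one_right h]
  exact (↑u⁻¹ : integralClosure A K).2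

/-! ### From a domain to a local normalization -/

/-- In an Artinian ring every element has a power that divides an idempotent which is a multiple
of the element and acts as the identity on that power. -/
theorem IsArtinianRing.exists_isIdempotentElem {R : Type*} [CommRing R] [IsArtinianRing R]
    (x : R) : ∃ (n : ℕ) (y : R), IsIdempotentElem ((x * y) ^ (n + 1)) ∧
      x ^ (n + 1) * (x * y) ^ (n + 1) = x ^ (n + 1) := by
  obtain ⟨n, y, hy⟩ := IsArtinian.exists_pow_succ_smul_dvd x (1 : R)
  simp only [smul_eq_mul, mul_one, Nat.succ_eq_add_one] at hy
  have key (j : ℕ) : x ^ (n + 1) * (x * y) ^ j = x ^ (n + 1) := by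
    induction j with
    | zero => simp
    | succ j ih => linear_combination x * y * ih + x * hy
  refine ⟨n, y, ?_, key _⟩
  have := key (n + 1)
  rw [IsIdempotentElem, mul_pow] at *
  linear_combination y ^ (n + 1) * this

theorem Ideal.isArtinianRing_quotient_of_krullDimLE_one {A : Type*} [CommRing A] [IsDomain A]
    [IsNoetherianRing A] [Ring.KrullDimLE 1 A] {I : Ideal A} (hI : I ≠ ⊥) :
    IsArtinianRing (A ⧸ I) := by
  rw [isArtinianRing_iff_krullDimLE_zero,
    Ideal.krullDimLE_zero_quotient_iff_forall_minimalPrimes_isMaximal]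
  intro J hJ
  refine hJ.1.1.isMaximal_of_ne_bot ?_
  rintro rfl
  exact hI (le_bot_iff.1 hJ.1.2)

section

variable {A : Type*} [CommRing A] [IsDomain A] [IsLocalRing A] [IsNoetherianRing A]
  [Ring.KrullDimLE 1 A] (K : Type*) [Field K] [Algebra A K] [IsFractionRing A K]

namespace LocalCompletion

theorem isDomain_of_isLocalRing_integralClosure (hA : ¬ IsField A) [IsReduced (LocalCompletion A)]
    [IsLocalRing (integralClosure A K)] : IsDomain (LocalCompletion A) := by
  have := isNoetherianRing hA
  by_contra hdom
  obtain ⟨b, c, hb, hc, hbc, hs⟩ := exists_mul_eq_zero_and_add_notMem_minimalPrimes hdom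
  obtain ⟨k, hk⟩ := exists_maximalIdeal_pow_le_span_singleton hA hs
  -- Precision `2k + 1` puts `b₀c₀` in `((b₀ + c₀)²)`; it also exceeds `k`, so the errors are `b₀ +
  -- c₀` times elements of the maximal ideal.
  obtain ⟨b₀, hb₀⟩ := exists_sub_algebraMap_mem (2 * k + 1) b
  obtain ⟨c₀, hc₀⟩ := exists_sub_algebraMap_mem (2 * k + 1) c
  let f := algebraMap A (LocalCompletion A)
  have hle : maximalIdeal (LocalCompletion A) ^ (2 * k + 1) ≤
      maximalIdeal (LocalCompletion A) ^ (k + 1) := Ideal.pow_le_pow_right (by omega)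
  have hassoc : Associated (b + c) (f (b₀ + c₀)) := by
    refine associated_of_sub_mem hk ?_
    rw [map_add, add_sub_add_comm]
    exact hle (add_mem hb₀ hc₀)
  have hs₀ (P) (hP : P ∈ minimalPrimes (LocalCompletion A)) : f (b₀ + c₀) ∉ P := fun h =>
    hs P hP (P.mem_of_dvd hassoc.symm.dvd h)
  have hsn := mem_nonZeroDivisors_of_notMem_minimalPrimes hs₀
  have hne : b₀ + c₀ ≠ 0 := by
    intro h
    rw [h, map_zero] at hsn
    exact zero_notMem_nonZeroDivisors hsn
  replace hk := hk.trans (Ideal.span_singleton_le_span_singleton.2 hassoc.symm.dvd)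
  have hkA := maximalIdeal_pow_le_span_singleton_of_algebraMap hne hk
  have hδ {y : LocalCompletion A} {y₀ : A}
      (h : y - f y₀ ∈ maximalIdeal (LocalCompletion A) ^ (2 * k + 1)) :
      ∃ δ ∈ maximalIdeal (LocalCompletion A), f (b₀ + c₀) * δ = y - f y₀ := by
    have h1 := hle h
    rw [pow_succ] at h1
    exact Ideal.mem_span_singleton_mul.1 (Ideal.mul_mono_left hk h1)
  obtain ⟨δ, hδm, hδe⟩ := hδ hb₀
  obtain ⟨δ', hδm', hδe'⟩ := hδ hc₀
  obtain ⟨ε, hε⟩ : ∃ ε, (b₀ + c₀) * (b₀ + c₀) * ε = b₀ * c₀ := by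
    have h1 : b₀ * c₀ ∈ maximalIdeal A ^ (2 * k + 1) := by
      rw [← algebraMap_mem_maximalIdeal_pow_iff, map_mul]
      have : f b₀ * f c₀ = -((b - f b₀) * f c₀ + b * (c - f c₀)) := by
        linear_combination hbc
      rw [this]
      exact neg_mem (add_mem (Ideal.mul_mem_right _ _ hb₀) (Ideal.mul_mem_left _ _ hc₀))
    have h2 := Ideal.pow_le_pow_right (show k + k ≤ 2 * k + 1 by omega) h1
    rw [pow_add] at h2
    have h3 := Ideal.mul_mono hkA hkA h2
    rw [Ideal.span_singleton_mul_span_singleton] at h3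
    obtain ⟨ε, hε⟩ := Ideal.mem_span_singleton.1 h3
    exact ⟨ε, hε.symm⟩
  let g := algebraMap A K
  have hgs : g (b₀ + c₀) ≠ 0 := (map_ne_zero_iff g (IsFractionRing.injective A K)).2 hne
  set x := g b₀ / g (b₀ + c₀) with hx
  have hbx : g b₀ = g (b₀ + c₀) * x := (mul_div_cancel₀ _ hgs).symm
  have hcx : g c₀ = g (b₀ + c₀) * (1 - x) := by
    rw [mul_sub, ← hbx, map_add]
    ring
  have hxε : x * (1 - x) = g ε := by
    have h := congrArg g hε
    rw [map_mul, map_mul, map_mul, hbx, hcx] at h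
    refine mul_left_cancel₀ (mul_ne_zero hgs hgs) ?_
    linear_combination -h
  have hint : IsIntegral A x := by
    refine ⟨X ^ 2 - X + C ε, by monicity!, ?_⟩
    simp only [eval₂_add, eval₂_sub, eval₂_pow, eval₂_X, eval₂_C]
    linear_combination -hxε
  rcases isUnit_or_isUnit_one_sub_self (⟨x, hint⟩ : integralClosure A K) with h | h
  · obtain ⟨h0, h1⟩ := integralClosure.isIntegral_inv_of_isUnit h
    refine hc (eq_zero_of_isIntegral_inv (b := b₀) (δ := -δ) hsn (neg_mem hδm) ?_ hbx h0 h1)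
    linear_combination c * hδe + hbc
  · obtain ⟨h0, h1⟩ := integralClosure.isIntegral_inv_of_isUnit h
    refine hb (eq_zero_of_isIntegral_inv (b := c₀) (δ := -δ') hsn (neg_mem hδm') ?_ hcx h0 h1)
    linear_combination b * hδe' + hbc

/-- An approximate idempotent of the fraction field lies in the base ring when the completion is a
domain. -/
theorem exists_algebraMap_eq_or_of_isDomain [IsDomain (LocalCompletion A)] {p q δ : A}
    (hq : q ≠ 0) (hδ : δ ∈ maximalIdeal A) (h : p * (q - p) = q ^ 2 * δ) :
    ∃ e ∈ maximalIdeal A, p = q * e ∨ q - p = q * e := by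
  let f := algebraMap A (LocalCompletion A)
  have hfq : f q ≠ 0 := (map_ne_zero_iff f algebraMap_injective).2 hq
  have hfδ : f δ ∈ maximalIdeal (LocalCompletion A) := by
    simpa only [pow_one] using (algebraMap_mem_maximalIdeal_pow_iff 1 δ).2 (by simpa only [pow_one])
  -- The derivative at 0 is -1, so the root 0 lifts to `r`; the other root is `1 - r`, and in a
  -- domain `p/q` must be one of the two.
  obtain ⟨r, hr, hrm⟩ := HenselianRing.is_henselian (I := maximalIdeal (LocalCompletion A))
    (X ^ 2 - X + C (f δ)) (by monicity!) 0 (by simpa using hfδ) (by simp)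
  rw [sub_zero] at hrm
  simp only [IsRoot.def, eval_add, eval_sub, eval_pow, eval_X, eval_C] at hr
  have hmul : (f p - f q * r) * (f (q - p) - f q * r) = 0 := by
    have h' := congrArg f h
    simp only [map_mul, map_sub, map_pow] at h' ⊢
    linear_combination h' + f q ^ 2 * hr
  have key {t : A} (ht : f t - f q * r = 0) : ∃ e ∈ maximalIdeal A, t = q * e := by
    rw [sub_eq_zero] at ht
    obtain ⟨e, rfl⟩ := dvd_of_algebraMap_eq_mul hq ht
    refine ⟨e, ?_, rfl⟩
    rw [map_mul] at ht
    rw [← pow_one (maximalIdeal A), ← algebraMap_mem_maximalIdeal_pow_iff, pow_one]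
    exact mul_left_cancel₀ hfq ht ▸ hrm
  rcases mul_eq_zero.1 hmul with h1 | h1
  · obtain ⟨e, he, h2⟩ := key h1
    exact ⟨e, he, .inl h2⟩
  · obtain ⟨e, he, h2⟩ := key h1
    exact ⟨e, he, .inr h2⟩

theorem isLocalRing_integralClosure_of_isDomain (hA : ¬ IsField A) [IsDomain (LocalCompletion A)] :
    IsLocalRing (integralClosure A K) := by
  refine IsLocalRing.of_isUnit_or_isUnit_one_sub_self fun x => ?_
  by_contra! hcon
  obtain ⟨hx, hx1⟩ := hcon
  obtain ⟨a, ham, ha⟩ := Submodule.exists_mem_ne_zero_of_ne_bot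
    (isField_iff_maximalIdeal_eq.not.1 hA)
  let g := algebraMap A K
  have hg : Function.Injective g := IsFractionRing.injective A K
  let S := Algebra.adjoin A {x.1}
  have hfg : (Subalgebra.toSubmodule S).FG := IsIntegral.fg_adjoin_singleton x.2
  have : Module.Finite A S := Module.Finite.iff_fg.2 hfg
  have hSle : S ≤ integralClosure A K := adjoin_le_integralClosure x.2
  obtain ⟨d, hd, hdS⟩ := FractionalIdeal.isFractional_of_fg (S := nonZeroDivisors A) hfg
  have hd0 : d ≠ 0 := nonZeroDivisors.ne_zero hd
  -- The factor `d` clears the denominators of `S`; the factor `a` puts `q` in the maximal ideal.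
  set q := a * d with hq
  have hq0 : q ≠ 0 := mul_ne_zero ha hd0
  have hqm : q ∈ maximalIdeal A := Ideal.mul_mem_right _ _ ham
  have hqS (z : S) : ∃ t : A, g t = g q * z := by
    obtain ⟨t, ht⟩ := hdS z z.2
    refine ⟨a * t, ?_⟩
    rw [map_mul, ht, Algebra.smul_def, hq, map_mul, mul_assoc]
  -- In `e - e² = q²w`, one factor `q` brings `w` into `A`; the other keeps the error in the maximal
  -- ideal.
  let I : Ideal A := Ideal.span {q ^ 2}
  have hI : I ≠ ⊥ := by simpa [I] using hq0
  have := Ideal.isArtinianRing_quotient_of_krullDimLE_one hI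
  have := IsArtinianRing.of_finite (A ⧸ I) (S ⧸ I.map (algebraMap A S))
  have hmem {z : S} (hz : z ∈ I.map (algebraMap A S)) : ∃ w : S, z = algebraMap A S (q ^ 2) * w := by
    rw [Ideal.map_span, Set.image_singleton] at hz
    exact Ideal.mem_span_singleton.1 hz
  let ξ : S := ⟨x.1, Algebra.self_mem_adjoin_singleton A x.1⟩
  obtain ⟨n, y, hidem, hpow⟩ := IsArtinianRing.exists_isIdempotentElem
    (Ideal.Quotient.mk (I.map (algebraMap A S)) ξ)
  obtain ⟨y, rfl⟩ := Ideal.Quotient.mk_surjective y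
  set e : S := (ξ * y) ^ (n + 1) with he
  rw [IsIdempotentElem, ← map_mul, ← map_pow, ← map_mul, eq_comm, Ideal.Quotient.eq] at hidem
  rw [← map_mul, ← map_pow, ← map_pow, ← map_mul, eq_comm, Ideal.Quotient.eq] at hpow
  obtain ⟨w, hw⟩ := hmem hidem
  obtain ⟨v, hv⟩ := hmem hpow
  obtain ⟨p, hp⟩ := hqS e
  obtain ⟨t, ht⟩ := hqS w
  have hpq : p * (q - p) = q ^ 2 * (q * t) := by
    apply hg
    have hw' : (e : K) - e * e = g (q ^ 2) * w := congrArg (Subtype.val : S → K) hw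
    simp only [map_mul, map_sub, map_pow] at hw' ⊢
    rw [hp, ht]
    linear_combination g q ^ 2 * hw'
  obtain ⟨u, hum, hu⟩ := exists_algebraMap_eq_or_of_isDomain hq0 (Ideal.mul_mem_right _ _ hqm) hpq
  have huu : IsUnit (1 - u) := (isUnit_or_isUnit_one_sub_self u).resolve_left hum
  let j : S →ₐ[A] integralClosure A K := Subalgebra.inclusion hSle
  have hjξ : j ξ = x := rfl
  have hgq : g q ≠ 0 := (map_ne_zero_iff g hg).2 hq0
  rcases hu with hu | hu
  · have hej : j e = algebraMap A _ u := by
      apply Subtype.ext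
      refine mul_left_cancel₀ hgq ?_
      change g q * (e : K) = g q * g u
      rw [← hp, hu, map_mul]
    -- As `e` lies in the maximal ideal of `A`, the relation for `x ^ (n + 1)` forces `x` into `M`,
    -- which already contains `1 - x`.
    obtain ⟨M, hM, hxM⟩ := exists_max_ideal_of_mem_nonunits hx1
    have hqM : algebraMap A (integralClosure A K) q ∈ M := by
      have := Ideal.isMaximal_comap_of_isIntegral_of_isMaximal (R := A) M
      have := eq_maximalIdeal this
      rw [← Ideal.mem_comap, this]
      exact hqm
    have h1 : x ^ (n + 1) * algebraMap A _ (1 - u) ∈ M := by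
      have := congrArg j hv
      rw [map_sub, map_mul, map_mul, hej, map_pow, hjξ, AlgHom.commutes, map_pow] at this
      rw [map_sub, map_one, mul_sub, mul_one, this]
      exact M.mul_mem_right _ (M.pow_mem_of_mem hqM 2 (by norm_num))
    have h2 : x ^ (n + 1) ∈ M :=
      (M.mul_unit_mem_iff_mem (huu.map (algebraMap A (integralClosure A K)))).1 h1
    have h3 := M.add_mem (hM.isPrime.mem_of_pow_mem _ h2) hxM
    rw [add_sub_cancel] at h3
    exact hM.ne_top ((Ideal.eq_top_iff_one M).2 h3)
  · have hej : j e = algebraMap A _ (1 - u) := by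
      apply Subtype.ext
      refine mul_left_cancel₀ hgq ?_
      change g q * (e : K) = g q * g (1 - u)
      rw [← hp, ← map_mul, mul_sub, ← hu, mul_one, sub_sub_cancel]
    have h1 : IsUnit (j e) := hej ▸ huu.map _
    rw [he, map_pow, map_mul, isUnit_pow_succ_iff] at h1
    exact hx (isUnit_of_mul_isUnit_left h1)

end LocalCompletion

end

/-! ### Identification of `A` with its reduction, and conclusion -/

theorem IsFractionRing.of_algebraMap_bijective {A B K : Type*} [CommRing A] [CommRing B]
    [CommRing K] [Algebra A B] [Algebra A K] [Algebra B K] [IsScalarTower A B K]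
    (h : Function.Bijective (algebraMap A B)) [IsFractionRing B K] : IsFractionRing A K := by
  let φ : A ≃+* B := RingEquiv.ofBijective (algebraMap A B) h
  exact IsLocalization.of_ringEquiv_left φ (MulEquivClass.map_nonZeroDivisors φ)
    (IsScalarTower.algebraMap_apply A B K)

theorem isLocalRing_integralClosure_iff {A B K : Type*} [CommRing A] [CommRing B]
    [CommRing K] [Algebra A B] [Algebra A K] [Algebra B K] [IsScalarTower A B K]
    [Algebra.IsIntegral A B] :
    IsLocalRing (integralClosure A K) ↔ IsLocalRing (integralClosure B K) := by
  let φ : integralClosure A K ≃+* integralClosure B K :=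
    { toFun x := ⟨x.1, IsIntegral.tower_top x.2⟩
      invFun x := ⟨x.1, isIntegral_trans (R := A) x.1 x.2⟩
      left_inv _ := rfl
      right_inv _ := rfl
      map_mul' _ _ := rfl
      map_add' _ _ := rfl }
  exact ⟨fun _ => φ.isLocalRing, fun _ => φ.symm.isLocalRing⟩

theorem corollary4p5 {A : Type*} [CommRing A] [IsDomain A] [IsLocalRing A] [IsNoetherianRing A]
    (hdim : ringKrullDim A = 1) :
    ((algebraMap A (LocalCompletion A)).IsWeierstrass ↔
      IsAnalyticallyUnramified A ∧ IsUnibranch A) ∧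
    ((algebraMap A (LocalCompletion A)).IsWeierstrass ↔ IsDomain (LocalCompletion A)) := by
  have : Ring.KrullDimLE 1 A := Ring.krullDimLE_iff.2 (by simp [hdim])
  have hA : ¬ IsField A := fun h => by
    rw [ringKrullDim_eq_zero_of_isField h] at hdim
    exact zero_ne_one hdim
  have hdomain : IsDomain (A ⧸ nilradical A) := by
    rw [Ideal.Quotient.isDomain_iff_prime, nilradical_eq_zero]
    exact Ideal.isPrime_bot
  have : IsFractionRing A (FractionRing (A ⧸ nilradical A)) := by
    refine IsFractionRing.of_algebraMap_bijective (B := A ⧸ nilradical A)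
      ⟨?_, Ideal.Quotient.mk_surjective⟩
    rw [RingHom.injective_iff_ker_eq_bot, Ideal.Quotient.algebraMap_eq, Ideal.mk_ker,
      nilradical_eq_zero, Ideal.zero_eq_bot]
  have huni : IsUnibranch A ↔
      IsLocalRing (integralClosure A (FractionRing (A ⧸ nilradical A))) :=
    (and_iff_right hdomain).trans isLocalRing_integralClosure_iff.symm
  have hiff : (algebraMap A (LocalCompletion A)).IsWeierstrass ↔ IsDomain (LocalCompletion A) :=
    ⟨LocalCompletion.isDomain_of_isWeierstrass,
      fun _ => LocalCompletion.isWeierstrass_of_isDomain hA⟩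
  refine ⟨hiff.trans ⟨fun _ => ⟨inferInstanceAs (IsReduced (LocalCompletion A)), ?_⟩, ?_⟩, hiff⟩
  · rw [huni]
    exact LocalCompletion.isLocalRing_integralClosure_of_isDomain _ hA
  · rintro ⟨hred, hlocal⟩
    rw [huni] at hlocal
    have : IsReduced (LocalCompletion A) := hred
    exact LocalCompletion.isDomain_of_isLocalRing_integralClosure
      (FractionRing (A ⧸ nilradical A)) hA
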